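/- Let $(\Xi,\mathscr M)$ be a measurable space, let $H$ be a (real or complex) separable Hilbert space, and let $L^2_H$ be the space of square-integrable $H$-valued random variables on a fixed probability space, with norm $\|X\|_{L^2_H}=(\mathbb E\|X\|^2)^{1/2}$ and random variables that agree almost surely identified. The inner product of $H$ is linear in its first argument. Let $\{X_\xi\}_{\xi\in\Xi}\subseteq L^2_H$ be such that the map $\xi\mapsto X_\xi$ is measurable from $\Xi$ to $L^2_H$ with its Borel $\sigma$-algebra. Let $n\ge 1$ be an integer with $n\le\dim H$ (no restriction if $\dim H=\infty$). Then there exist measurable maps $v_1,\dots,v_n:\Xi\to H$ such that, for all $\xi\in\Xi$, $\langle v_i(\xi),v_j(\xi)\rangle=\delta_{i,j}$ for $i,j=1,\dots,n$, and $$\mathbb E\Big\|X_\xi-\sum_{i=1}^n\langle X_\xi,v_i(\xi)\rangle v_i(\xi)\Big\|^2=\inf_{Z\in Q_n}\mathbb E\|X_\xi-Z\|^2,$$ where $$Q_n=\{Z\in L^2_H:\ \text{there is a linear subspace } V\subseteq H \text{ with } \dim V\le n \text{ and } Z\in V \text{ almost surely}\}.$$ Furthermore, these maps $v_1,\dots,v_n$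 can be chosen so that, whenever $\Xi$ is equipped with a topology for which $\mathbb E\|X_\xi-X_{\xi'}\|^2\to0$ as $\xi\to\xi'$, for every $\xi'\in\Xi$, the maps $\xi\mapsto\mathbb E|\langle X_\xi,v_i(\xi)\rangle|^2$, $i=1,\dots,n$, are continuous. -/

import Mathlib

open MeasureTheory Filter Topology
open scoped ENNReal

/-- The set `Q_n` of (classes of) square-integrable `H`-valued random variables that take values
almost surely in some linear subspace of dimension at most `n`. The dimension is the cardinal
`Module.rank`, so infinite-dimensional subspaces are excluded. -/
def lowRankVariables (𝕜 : Type*) {H S : Type*} [RCLike 𝕜] [NormedAddCommGroup H]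
    [InnerProductSpace 𝕜 H] [MeasurableSpace S] (P : Measure S) (n : ℕ) : Set (Lp H 2 P) :=
  {Z | ∃ V : Submodule 𝕜 H, Module.rank 𝕜 V ≤ (n : Cardinal) ∧ ∀ᵐ ω ∂P, Z ω ∈ V}

/-! Fix `X` and let `A u = ⟨X, u⟩`, an operator from `H` to scalar L². It is compact, and `A* A` is
the second-moment operator of `X`. Projecting `X` onto the span of orthonormal `v i` leaves the
error `‖X‖² - ∑ ‖A (v i)‖²`, so the task is to maximize this sum. By Ky Fan's principle
(`IsLeadingSingularFamily.sum_norm_sq_le`) leading singular vectors do so.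

For measurability in `ξ` the vectors are chosen one at a time. If `Q` projects onto the orthogonal
complement of those already chosen and `T = Q A* A Q`, the next one is a unit vector with `Q w = w`
and `T w = ‖T‖ w`. Both conditions together say that `w` is fixed by the contraction `(1 + ‖T‖)⁻¹ (Q
+ T)`. The mean ergodic theorem exhibits the projection onto its fixed space as a limit of
measurable maps, which yields a measurable choice even when eigenvalues cross.

The `v i` may jump, but `‖A (v i)‖²` is a difference of squared distances from `X` to consecutive
sets `Q_k`, hence continuous in `X`. -/

open ContinuousLinearMap Module.End

/-! ### Measurable selection of fixed vectors -/

section MeasurableFamilies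

variable {𝕜 Ξ H : Type*} [RCLike 𝕜] [MeasurableSpace Ξ] [NormedAddCommGroup H]
  [InnerProductSpace 𝕜 H] [TopologicalSpace.SeparableSpace H] [MeasurableSpace H] [BorelSpace H]

/-- A pointwise measurable family of bounded operators on a separable space maps measurable
families of vectors to measurable families of vectors. -/
theorem measurable_clm_apply {f : Ξ → H →L[𝕜] H} (hf : ∀ u, Measurable fun ξ => f ξ u)
    {w : Ξ → H} (hw : Measurable w) : Measurable fun ξ => f ξ (w ξ) := by
  have : SecondCountableTopology H := UniformSpace.secondCountable_of_separable H
  have h : Measurable (Function.uncurry fun u ξ => f ξ u) :=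
    measurable_uncurry_of_continuous_of_measurable (fun ξ => (f ξ).continuous) hf
  exact h.comp (hw.prodMk measurable_id)

/-- The operator norm of a pointwise measurable family of bounded operators is measurable. -/
theorem measurable_opNorm {f : Ξ → H →L[𝕜] H} (hf : ∀ u, Measurable fun ξ => f ξ u) :
    Measurable fun ξ => ‖f ξ‖ := by
  refine measurable_of_Iic fun c => ?_
  rcases lt_or_ge c 0 with hc | hc
  · convert MeasurableSet.empty
    ext ξ
    simpa using hc.trans_le (norm_nonneg _)
  · have : (fun ξ => ‖f ξ‖) ⁻¹' Set.Iic c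
        = ⋂ j, {ξ | ‖f ξ (TopologicalSpace.denseSeq H j)‖
            ≤ c * ‖TopologicalSpace.denseSeq H j‖} := by
      ext ξ
      simp only [Set.mem_preimage, Set.mem_Iic, Set.mem_iInter, Set.mem_ofPred_eq]
      refine ⟨fun h j => (f ξ).le_of_opNorm_le h _, fun h => opNorm_le_bound _ hc fun x => ?_⟩
      have hcl : IsClosed {x | ‖f ξ x‖ ≤ c * ‖x‖} := isClosed_le (by fun_prop) (by fun_prop)
      exact (hcl.closure_subset_iff.2 (Set.range_subset_iff.2 h))
        (TopologicalSpace.denseRange_denseSeq H x)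
    rw [this]
    exact MeasurableSet.iInter fun j => measurableSet_le (hf _).norm measurable_const

/-- A pointwise measurable family of contractions, each with a nonzero fixed vector, has a
measurable family of fixed unit vectors. -/
theorem exists_measurable_fixed_unit_vector [CompleteSpace H] {f : Ξ → H →L[𝕜] H}
    (hf : ∀ u, Measurable fun ξ => f ξ u) (hf₁ : ∀ ξ, ‖f ξ‖ ≤ 1)
    (hfix : ∀ ξ, ∃ u, u ≠ 0 ∧ f ξ u = u) :
    ∃ v : Ξ → H, Measurable v ∧ ∀ ξ, ‖v ξ‖ = 1 ∧ f ξ (v ξ) = v ξ := by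
  classical
  have : SecondCountableTopology H := UniformSpace.secondCountable_of_separable H
  let e := TopologicalSpace.denseSeq H
  let p : ℕ → Ξ → H := fun j ξ =>
    ((f ξ).eqLocus (1 : H →L[𝕜] H)).orthogonalProjectionOnto (e j)
  -- Von Neumann's mean ergodic theorem: Birkhoff averages of a contraction converge to the
  -- projection onto its fixed space.
  have hp (j) : Measurable (p j) := by
    refine measurable_of_tendsto_metrizable
      (f := fun n ξ => birkhoffAverage 𝕜 (f ξ) _root_.id n (e j)) (fun n => ?_)
      (tendsto_pi_nhds.2 fun ξ =>
        (f ξ).tendsto_birkhoffAverage_orthogonalProjection (hf₁ ξ) (e j))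
    have hit (k : ℕ) : Measurable fun ξ => (f ξ)^[k] (e j) := by
      induction k with
      | zero => exact measurable_const
      | succ k ih =>
        simp only [Function.iterate_succ_apply']
        exact measurable_clm_apply hf ih
    simp only [birkhoffAverage, birkhoffSum, _root_.id]
    exact (Finset.measurable_sum _ fun k _ => hit k).const_smul _
  -- A dense sequence has a term not orthogonal to the fixed vector `u`, and its projection cannot
  -- vanish.
  have hne (ξ) : ∃ j, p j ξ ≠ 0 := by
    obtain ⟨u, hu, hfu⟩ := hfix ξ
    have hopen : IsOpen {x : H | inner 𝕜 u x ≠ 0} :=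
      isOpen_ne_fun (by fun_prop) continuous_const
    obtain ⟨j, hj⟩ := (TopologicalSpace.denseRange_denseSeq H).exists_mem_open hopen
      ⟨u, by simpa using hu⟩
    refine ⟨j, fun h => hj ?_⟩
    have hmem : u ∈ (f ξ).eqLocus (1 : H →L[𝕜] H) := hfu
    have := Submodule.inner_orthogonalProjectionOnto_eq_of_mem_left
      (⟨u, hmem⟩ : (f ξ).eqLocus (1 : H →L[𝕜] H)) (e j)
    rw [← this]
    have h0 : ((f ξ).eqLocus (1 : H →L[𝕜] H)).orthogonalProjectionOnto (e j) = 0 :=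
      Subtype.ext h
    rw [h0, inner_zero_right]
  let q : Ξ → H := fun ξ => p (Nat.find (hne ξ)) ξ
  have hq : Measurable q :=
    Measurable.find hp (fun n => (hp n (measurableSet_singleton 0)).compl) hne
  have hq₀ (ξ) : q ξ ≠ 0 := Nat.find_spec (hne ξ)
  have hfq (ξ) : f ξ (q ξ) = q ξ :=
    (((f ξ).eqLocus (1 : H →L[𝕜] H)).orthogonalProjectionOnto (e (Nat.find (hne ξ)))).2
  have hc : Measurable fun ξ => ((‖q ξ‖⁻¹ : ℝ) : 𝕜) :=
    RCLike.measurable_ofReal.comp hq.norm.inv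
  refine ⟨fun ξ => ((‖q ξ‖⁻¹ : ℝ) : 𝕜) • q ξ, hc.smul hq, fun ξ => ⟨?_, ?_⟩⟩
  · rw [norm_smul, RCLike.norm_ofReal, abs_of_nonneg (by positivity),
      inv_mul_cancel₀ (norm_ne_zero_iff.2 (hq₀ ξ))]
  · rw [map_smul, hfq]

end MeasurableFamilies

/-- A nonzero compact positive operator attains its norm as an eigenvalue. -/
theorem ContinuousLinearMap.IsPositive.exists_eigenvector_norm {𝕜 H : Type*} [RCLike 𝕜]
    [NormedAddCommGroup H] [InnerProductSpace 𝕜 H] [CompleteSpace H] {T : H →L[𝕜] H}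
    (hT : T.IsPositive) (hc : IsCompactOperator T) (h0 : T ≠ 0) :
    ∃ u, u ≠ 0 ∧ T u = (‖T‖ : 𝕜) • u := by
  have hT0 : (‖T‖ : 𝕜) ≠ 0 := by simpa using h0
  have : Nontrivial H := by
    obtain ⟨x, hx⟩ : ∃ x, T x ≠ 0 := by
      by_contra! h
      exact h0 (ContinuousLinearMap.ext h)
    exact ⟨_, _, hx⟩
  rcases hc.hasEigenvalue_or_mem_resolventSet hT0 with h | h
  · obtain ⟨u, hu⟩ := h.exists_hasEigenvector
    exact ⟨u, hu.2, hu.apply_eq_smul⟩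
  -- The other Fredholm alternative keeps the Rayleigh quotient a distance `ε` below `‖T‖`, although
  -- for positive `T` its supremum is `‖T‖`.
  · obtain ⟨ε, hε, hle⟩ := T.rayleighQuotient_le_of_norm_mem_resolventSet h
    have : ‖T‖ ≤ ‖T‖ - ε := by
      conv_lhs => rw [T.norm_eq_iSup_rayleighQuotient hT.isSymmetric]
      refine ciSup_le fun x => ?_
      rw [abs_of_nonneg]
      · exact hle x
      · exact div_nonneg (hT.re_inner_nonneg_left x) (by positivity)
    linarith

/-! ### Orthonormal families and projections -/

section OrthonormalFamilies

variable {𝕜 H : Type*} [RCLike 𝕜] [NormedAddCommGroup H] [InnerProductSpace 𝕜 H]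

theorem Submodule.mem_orthogonal_span_range {ι : Type*} {v : ι → H} {u : H} :
    u ∈ (Submodule.span 𝕜 (Set.range v))ᗮ ↔ ∀ i, inner 𝕜 (v i) u = 0 := by
  rw [Submodule.mem_orthogonal]
  refine ⟨fun h i => h _ (Submodule.subset_span ⟨i, rfl⟩), fun h x hx => ?_⟩
  induction hx using Submodule.span_induction with
  | mem x hx => obtain ⟨i, rfl⟩ := hx; exact h i
  | zero => exact inner_zero_left _
  | add x y _ _ hx hy => rw [inner_add_left, hx, hy, add_zero]
  | smul a x _ hx => rw [inner_smul_left, hx, mul_zero]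

theorem Orthonormal.norm_sub_sum_inner_sq {ι : Type*} [Fintype ι] {v : ι → H}
    (hv : Orthonormal 𝕜 v) (u : H) :
    ‖u - ∑ i, inner 𝕜 (v i) u • v i‖ ^ 2 = ‖u‖ ^ 2 - ∑ i, ‖inner 𝕜 (v i) u‖ ^ 2 := by
  classical
  have h₁ : inner 𝕜 (∑ i, inner 𝕜 (v i) u • v i) u = ((∑ i, ‖inner 𝕜 (v i) u‖ ^ 2 : ℝ) : 𝕜) := by
    rw [sum_inner, RCLike.ofReal_sum]
    refine Finset.sum_congr rfl fun i _ => ?_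
    rw [inner_smul_left, RCLike.conj_mul, RCLike.ofReal_pow]
  have h₂ : ‖∑ i, inner 𝕜 (v i) u • v i‖ ^ 2 = ∑ i, ‖inner 𝕜 (v i) u‖ ^ 2 := by
    rw [← inner_self_eq_norm_sq (𝕜 := 𝕜), hv.inner_sum, map_sum]
    refine Finset.sum_congr rfl fun i _ => ?_
    rw [RCLike.conj_mul, ← RCLike.ofReal_pow, RCLike.ofReal_re]
  rw [norm_sub_sq (𝕜 := 𝕜), ← inner_conj_symm, h₁, RCLike.conj_ofReal, RCLike.ofReal_re, h₂]
  ring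

/-- Fixed points of `(1 + ‖T‖)⁻¹ (Q + T)`, where `Q` is an idempotent with `Q T = T`. -/
theorem fixed_of_smul_add_fixed {Q T : H →L[𝕜] H} (hQ : ∀ u, Q (Q u) = Q u)
    (hQT : ∀ u, Q (T u) = T u) {w : H} (hw : ((1 + ‖T‖ : ℝ) : 𝕜)⁻¹ • (Q w + T w) = w) :
    Q w = w ∧ T w = (‖T‖ : 𝕜) • w := by
  -- `Q` fixes the left side of `hw`, hence also `w`.
  have hQw : Q w = w := by
    conv_lhs => rw [← hw]
    rw [map_smul, map_add, hQ, hQT, hw]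
  refine ⟨hQw, ?_⟩
  have h0 : ((1 + ‖T‖ : ℝ) : 𝕜) ≠ 0 := by
    exact_mod_cast (by positivity : (1 + ‖T‖ : ℝ) ≠ 0)
  rw [inv_smul_eq_iff₀ h0, hQw, RCLike.ofReal_add, RCLike.ofReal_one, add_smul, one_smul] at hw
  exact add_left_cancel hw

end OrthonormalFamilies

/-! ### Leading singular vectors and Ky Fan's principle -/

section LeadingSingularFamilies

variable {𝕜 H E : Type*} [RCLike 𝕜] [NormedAddCommGroup H] [InnerProductSpace 𝕜 H]
  [CompleteSpace H] [NormedAddCommGroup E] [InnerProductSpace 𝕜 E] [CompleteSpace E]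

/-- An orthonormal family of right singular vectors of `A`, each of which maximizes `‖A u‖` among
the unit vectors orthogonal to its predecessors. -/
structure IsLeadingSingularFamily (A : H →L[𝕜] E) {n : ℕ} (v : Fin n → H) : Prop where
  orthonormal : Orthonormal 𝕜 v
  adjoint_apply : ∀ i, adjoint A (A (v i)) = ((‖A (v i)‖ ^ 2 : ℝ) : 𝕜) • v i
  norm_le : ∀ i u, (∀ j < i, inner 𝕜 (v j) u = 0) → ‖A u‖ ^ 2 ≤ ‖A (v i)‖ ^ 2 * ‖u‖ ^ 2

theorem Orthonormal.starProjection_span_orthogonal {ι : Type*} [Fintype ι] {v : ι → H}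
    (hv : Orthonormal 𝕜 v) (u : H) :
    (Submodule.span 𝕜 (Set.range v))ᗮ.starProjection u = u - ∑ i, inner 𝕜 (v i) u • v i := by
  classical
  refine Submodule.eq_starProjection_of_mem_orthogonal
    (Submodule.mem_orthogonal_span_range.2 fun i => ?_) (Submodule.le_orthogonal_orthogonal _ ?_)
  · simp [inner_sub_right, inner_sum, inner_smul_right, orthonormal_iff_ite.1 hv]
  · rw [sub_sub_cancel]
    exact Submodule.sum_mem _ fun i _ => Submodule.smul_mem _ _ (Submodule.subset_span ⟨i, rfl⟩)

/-- The span of the eigenvectors `v i` is invariant under the self-adjoint `A* A`, hence so is its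
complement, on which `A* A` agrees with the compressed operator. A top eigenvector of the latter is
therefore a genuine eigenvector of `A* A`. -/
theorem IsLeadingSingularFamily.snoc {A : H →L[𝕜] E} {n : ℕ} {v : Fin n → H}
    (hv : IsLeadingSingularFamily A v) {Q : H →L[𝕜] H}
    (hQ : Q = (Submodule.span 𝕜 (Set.range v))ᗮ.starProjection) {w : H} (hw : ‖w‖ = 1)
    (hQw : Q w = w)
    (hTw : (adjoint (A ∘L Q) ∘L (A ∘L Q)) w = (‖adjoint (A ∘L Q) ∘L (A ∘L Q)‖ : 𝕜) • w) :
    IsLeadingSingularFamily A (Fin.snoc v w : Fin (n + 1) → H) := by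
  have hfix {u : H} : Q u = u ↔ ∀ i, inner 𝕜 (v i) u = 0 := by
    rw [hQ, Submodule.starProjection_eq_self_iff, Submodule.mem_orthogonal_span_range]
  have hQa : adjoint Q = Q := by rw [hQ]; exact isSelfAdjoint_starProjection _
  have hvw := hfix.1 hQw
  have hnorm : ‖A w‖ ^ 2 = ‖A ∘L Q‖ ^ 2 := by
    have h := apply_norm_sq_eq_inner_adjoint_left (A ∘L Q) w
    rw [hTw, inner_smul_left, RCLike.conj_ofReal, RCLike.re_ofReal_mul, inner_self_eq_norm_sq, hw,
      norm_adjoint_comp_self] at h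
    simpa [hQw, sq] using h
  refine ⟨?_, ?_, ?_⟩
  · refine ⟨fun i => ?_, fun i j hij => ?_⟩
    · induction i using Fin.lastCases with
      | last => simpa using hw
      | cast i => simpa using hv.orthonormal.1 i
    · induction i using Fin.lastCases with
      | last =>
        induction j using Fin.lastCases with
        | last => exact absurd rfl hij
        | cast j => simpa using inner_eq_zero_symm.1 (hvw j)
      | cast i =>
        induction j using Fin.lastCases with
        | last => simpa using hvw i
        | cast j => simpa using hv.orthonormal.2 (fun h => hij (congrArg _ h))
  · intro i
    induction i using Fin.lastCases with
    | cast i => simpa using hv.adjoint_apply i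
    | last =>
      simp only [Fin.snoc_last]
      have hC : Q (adjoint A (A w)) = adjoint A (A w) := by
        refine hfix.2 fun i => ?_
        rw [adjoint_inner_right, ← adjoint_inner_left, hv.adjoint_apply, inner_smul_left, hvw,
          mul_zero]
      rw [← hC, hnorm, sq, ← norm_adjoint_comp_self, ← hTw]
      simp [adjoint_comp, hQa, hQw]
  · intro i u hu
    induction i using Fin.lastCases with
    | cast i =>
      simp only [Fin.snoc_castSucc]
      exact hv.norm_le i u fun j hj => by
        simpa using hu j.castSucc (Fin.castSucc_lt_castSucc_iff.2 hj)
    | last =>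
      have hQu : Q u = u := hfix.2 fun i => by simpa using hu i.castSucc (Fin.castSucc_lt_last i)
      simp only [Fin.snoc_last]
      rw [hnorm, ← mul_pow]
      have := (A ∘L Q).le_opNorm u
      rw [comp_apply, hQu] at this
      gcongr

theorem IsLeadingSingularFamily.comp_castLE {A : H →L[𝕜] E} {n k : ℕ} {v : Fin n → H}
    (hv : IsLeadingSingularFamily A v) (hk : k ≤ n) :
    IsLeadingSingularFamily A (fun i : Fin k => v (Fin.castLE hk i)) where
  orthonormal := hv.orthonormal.comp _ (Fin.castLE_injective hk)
  adjoint_apply _ := hv.adjoint_apply _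
  norm_le i u hu := hv.norm_le (Fin.castLE hk i) u fun j hj =>
    hu ⟨j, lt_trans hj i.is_lt⟩ hj

/-- Measurable selection of leading singular vectors. -/
theorem exists_measurable_leadingSingularFamily {Ξ : Type*} [MeasurableSpace Ξ]
    [TopologicalSpace.SeparableSpace H] [MeasurableSpace H] [BorelSpace H] {A : Ξ → H →L[𝕜] E}
    (hA : ∀ u, Measurable fun ξ => adjoint (A ξ) (A ξ u)) (hc : ∀ ξ, IsCompactOperator (A ξ))
    (n : ℕ) (hn : (n : Cardinal) ≤ Module.rank 𝕜 H) :
    ∃ v : Fin n → Ξ → H, (∀ i, Measurable (v i)) ∧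
      ∀ ξ, IsLeadingSingularFamily (A ξ) fun i => v i ξ := by
  induction n with
  | zero =>
    exact ⟨fun i => i.elim0, fun i => i.elim0,
      fun ξ => ⟨⟨fun i => i.elim0, fun i => i.elim0⟩, fun i => i.elim0, fun i => i.elim0⟩⟩
  | succ n ih =>
    obtain ⟨v, hvm, hv⟩ := ih (le_trans (by exact_mod_cast n.le_succ) hn)
    have : SecondCountableTopology H := UniformSpace.secondCountable_of_separable H
    let Q : Ξ → H →L[𝕜] H := fun ξ =>
      (Submodule.span 𝕜 (Set.range fun i => v i ξ))ᗮ.starProjection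
    let T : Ξ → H →L[𝕜] H := fun ξ => adjoint (A ξ ∘L Q ξ) ∘L (A ξ ∘L Q ξ)
    have hQa (ξ) : adjoint (Q ξ) = Q ξ := isSelfAdjoint_starProjection _
    have hQQ (ξ u) : Q ξ (Q ξ u) = Q ξ u :=
      congrArg (fun f : H →L[𝕜] H => f u) (Submodule.isIdempotentElem_starProjection _).eq
    have hT (ξ u) : T ξ u = Q ξ (adjoint (A ξ) (A ξ (Q ξ u))) := by
      simp [T, adjoint_comp, hQa]
    have hQT (ξ u) : Q ξ (T ξ u) = T ξ u := by rw [hT, hQQ]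
    have hQm (u) : Measurable fun ξ => Q ξ u := by
      simp only [Q, (hv _).orthonormal.starProjection_span_orthogonal]
      refine measurable_const.sub (Finset.measurable_sum _ fun i _ => ?_)
      exact ((hvm i).inner measurable_const).smul (hvm i)
    have hTm (u) : Measurable fun ξ => T ξ u := by
      simp only [hT]
      exact measurable_clm_apply hQm
        (measurable_clm_apply (f := fun ξ => adjoint (A ξ) ∘L A ξ) hA (hQm u))
    have hQ1 (ξ) : ‖Q ξ‖ ≤ 1 := Submodule.starProjection_norm_le _
    -- Dividing by `1 + ‖T ξ‖` makes this a contraction. The summand `Q ξ` confines fixed vectors to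
    -- the complement even when `T ξ = 0`.
    obtain ⟨w, hwm, hw⟩ := exists_measurable_fixed_unit_vector
      (f := fun ξ => ((1 + ‖T ξ‖ : ℝ) : 𝕜)⁻¹ • (Q ξ + T ξ)) (fun u => by
        have hcm : Measurable fun ξ => ((1 + ‖T ξ‖ : ℝ) : 𝕜)⁻¹ :=
          (RCLike.measurable_ofReal.comp (measurable_const.add (measurable_opNorm hTm))).inv
        exact hcm.smul ((hQm u).add (hTm u))) (fun ξ => by
        rw [norm_smul, norm_inv, RCLike.norm_ofReal, abs_of_nonneg (by positivity)]
        exact inv_mul_le_one_of_le₀ ((norm_add_le _ _).trans (by gcongr; exact hQ1 ξ))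
          (by positivity)) (fun ξ => by
        obtain ⟨u, hu0, hQu, hTu⟩ : ∃ u, u ≠ 0 ∧ Q ξ u = u ∧ T ξ u = (‖T ξ‖ : 𝕜) • u := by
          by_cases h0 : T ξ = 0
          -- Any nonzero vector of the complement will do; one exists because `n` vectors cannot
          -- span a space of dimension at least `n + 1`.
          · have : FiniteDimensional 𝕜 (Submodule.span 𝕜 (Set.range fun i => v i ξ)) :=
              FiniteDimensional.span_of_finite 𝕜 (Set.finite_range _)
            have hK : (Submodule.span 𝕜 (Set.range fun i => v i ξ)) ≠ ⊤ := by
              intro h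
              have h1 := rank_span_le (R := 𝕜) (Set.range fun i => v i ξ)
              rw [h, rank_top] at h1
              have h2 : Cardinal.mk (Set.range fun i => v i ξ) ≤ n := by
                simpa using Cardinal.mk_range_le_lift (f := fun i : Fin n => v i ξ)
              exact absurd ((hn.trans h1).trans h2) (by exact_mod_cast n.lt_succ_self.not_ge)
            have hK' : (Submodule.span 𝕜 (Set.range fun i => v i ξ))ᗮ ≠ ⊥ := fun h =>
              hK ((Submodule.orthogonal_eq_bot_iff).1 h)
            obtain ⟨u, hu, hu0⟩ := Submodule.exists_mem_ne_zero_of_ne_bot hK'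
            exact ⟨u, hu0, Submodule.starProjection_eq_self_iff.2 hu, by simp [h0]⟩
          · have hTc : IsCompactOperator (T ξ) :=
              ((hc ξ).comp_clm (Q ξ)).clm_comp (adjoint (A ξ ∘L Q ξ))
            obtain ⟨u, hu0, hTu⟩ :=
              (isPositive_adjoint_comp_self (A ξ ∘L Q ξ)).exists_eigenvector_norm hTc h0
            refine ⟨u, hu0, ?_, hTu⟩
            have hl : (‖T ξ‖ : 𝕜) ≠ 0 := by simpa using h0
            have := hQT ξ u
            rw [show T ξ u = (‖T ξ‖ : 𝕜) • u from hTu, map_smul] at this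
            exact smul_right_injective H hl this
        refine ⟨u, hu0, ?_⟩
        have h0 : ((1 + ‖T ξ‖ : ℝ) : 𝕜) ≠ 0 := by
          exact_mod_cast (by positivity : (1 + ‖T ξ‖ : ℝ) ≠ 0)
        rw [smul_apply, add_apply, hQu, hTu, inv_smul_eq_iff₀ h0, RCLike.ofReal_add,
          RCLike.ofReal_one, add_smul, one_smul])
    refine ⟨Fin.snoc v w, fun i => ?_, fun ξ => ?_⟩
    · induction i using Fin.lastCases with
      | last => simpa using hwm
      | cast i => simpa using hvm i
    · obtain ⟨hQw, hTw⟩ := fixed_of_smul_add_fixed (hQQ ξ) (hQT ξ) (hw ξ).2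
      convert (hv ξ).snoc rfl (hw ξ).1 hQw hTw using 1
      ext i
      induction i using Fin.lastCases with
      | last => simp
      | cast i => simp

/-- Ky Fan's maximum principle. -/
theorem IsLeadingSingularFamily.sum_norm_sq_le {A : H →L[𝕜] E} {n : ℕ} {v : Fin n → H}
    (hv : IsLeadingSingularFamily A v) {ι : Type*} [Fintype ι] {f : ι → H}
    (hf : Orthonormal 𝕜 f) (hι : Fintype.card ι ≤ n) :
    ∑ j, ‖A (f j)‖ ^ 2 ≤ ∑ i, ‖A (v i)‖ ^ 2 := by
  -- `μ` is the smallest selected squared singular value; for an empty family `‖A‖ ^ 2` serves.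
  obtain ⟨μ, hμ0, hμ, hμle⟩ : ∃ μ : ℝ, 0 ≤ μ ∧ (∀ i, μ ≤ ‖A (v i)‖ ^ 2) ∧
      ∀ u, (∀ i, inner 𝕜 (v i) u = 0) → ‖A u‖ ^ 2 ≤ μ * ‖u‖ ^ 2 := by
    rcases n with _ | n
    · refine ⟨‖A‖ ^ 2, by positivity, fun i => i.elim0, fun u _ => ?_⟩
      rw [← mul_pow]
      gcongr
      exact A.le_opNorm u
    · refine ⟨‖A (v (Fin.last n))‖ ^ 2, by positivity, fun i => ?_,
        fun u hu => hv.norm_le _ u fun j _ => hu j⟩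
      simpa [hv.orthonormal.1] using hv.norm_le i (v (Fin.last n)) fun j hj =>
        hv.orthonormal.2 (ne_of_lt (hj.trans_le (Fin.le_last i)))
  have key (u : H) : ‖A u‖ ^ 2
      ≤ μ * ‖u‖ ^ 2 + ∑ i, (‖A (v i)‖ ^ 2 - μ) * ‖inner 𝕜 (v i) u‖ ^ 2 := by
    set s := ∑ i, inner 𝕜 (v i) u • v i with hs
    have hr (i) : inner 𝕜 (v i) (u - s) = 0 := by
      classical
      simp [hs, inner_sub_right, inner_sum, inner_smul_right, orthonormal_iff_ite.1 hv.orthonormal]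
    have hAs (y : H) : inner 𝕜 (A s) (A y)
        = ∑ i, (starRingEnd 𝕜) (inner 𝕜 (v i) u) *
          (((‖A (v i)‖ ^ 2 : ℝ) : 𝕜) * inner 𝕜 (v i) y) := by
      rw [hs, map_sum, sum_inner]
      refine Finset.sum_congr rfl fun i _ => ?_
      rw [map_smul, inner_smul_left, ← adjoint_inner_left, hv.adjoint_apply, inner_smul_left,
        RCLike.conj_ofReal]
    have hAss : ‖A s‖ ^ 2 = ∑ i, ‖A (v i)‖ ^ 2 * ‖inner 𝕜 (v i) u‖ ^ 2 := by
      have hvs (i) : inner 𝕜 (v i) s = inner 𝕜 (v i) u := by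
        rw [← sub_eq_zero, ← inner_sub_right, ← neg_sub, inner_neg_right, hr, neg_zero]
      rw [← inner_self_eq_norm_sq (𝕜 := 𝕜), hAs, map_sum]
      refine Finset.sum_congr rfl fun i _ => ?_
      rw [hvs, mul_left_comm, RCLike.conj_mul, ← RCLike.ofReal_pow, ← RCLike.ofReal_mul,
        RCLike.ofReal_re]
    -- Since the `v i` are eigenvectors of `A* A`, the operator `A` preserves the orthogonality of
    -- `s` and `u - s`.
    have hAu : ‖A u‖ ^ 2 = ‖A s‖ ^ 2 + ‖A (u - s)‖ ^ 2 := by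
      have h0 : inner 𝕜 (A s) (A (u - s)) = 0 := by
        simp only [hAs, hr, mul_zero, Finset.sum_const_zero]
      have := norm_add_sq (𝕜 := 𝕜) (A s) (A (u - s))
      rwa [h0, map_zero, mul_zero, add_zero, ← map_add, add_sub_cancel] at this
    have hle := hμle _ hr
    rw [hs, hv.orthonormal.norm_sub_sum_inner_sq, ← hs] at hle
    rw [hAu, hAss]
    simp only [sub_mul, Finset.sum_sub_distrib, ← Finset.mul_sum]
    linarith
  calc ∑ j, ‖A (f j)‖ ^ 2
      ≤ ∑ j, (μ + ∑ i, (‖A (v i)‖ ^ 2 - μ) * ‖inner 𝕜 (v i) (f j)‖ ^ 2) :=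
        Finset.sum_le_sum fun j _ => by simpa [hf.1] using key (f j)
    _ = Fintype.card ι * μ
        + ∑ i, (‖A (v i)‖ ^ 2 - μ) * ∑ j, ‖inner 𝕜 (f j) (v i)‖ ^ 2 := by
        simp_rw [Finset.sum_add_distrib, Finset.mul_sum, norm_inner_symm (f _)]
        rw [Finset.sum_comm]
        simp
    -- The cardinality bound with `μ ≥ 0`, and Bessel's inequality with nonnegative weights.
    _ ≤ n * μ + ∑ i, (‖A (v i)‖ ^ 2 - μ) * 1 := by
        gcongr with i
        · exact sub_nonneg.2 (hμ i)
        · simpa [hv.orthonormal.1] using hf.sum_inner_products_le (v i) (s := Finset.univ)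
    _ = ∑ i, ‖A (v i)‖ ^ 2 := by simp

end LeadingSingularFamilies

/-! ### The operator attached to a random variable -/

section InnerOperator

variable {𝕜 H S : Type*} [RCLike 𝕜] [NormedAddCommGroup H] [InnerProductSpace 𝕜 H]
  [MeasurableSpace S] {P : Measure S}

theorem Lp.norm_sq_eq_integral_norm_sq {F : Type*} [NormedAddCommGroup F] (f : Lp F 2 P) :
    ‖f‖ ^ 2 = ∫ ω, ‖f ω‖ ^ 2 ∂P := by
  have h : 0 ≤ ∫ ω, ‖f ω‖ ^ 2 ∂P := integral_nonneg fun ω => by positivity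
  rw [Lp.norm_def, (Lp.memLp f).eLpNorm_eq_integral_rpow_norm (by simp) (by simp),
    ENNReal.toReal_ofReal (by positivity)]
  simp only [ENNReal.toReal_ofNat, Real.rpow_two]
  rw [← Real.rpow_natCast, ← Real.rpow_mul h]
  simp

theorem Lp.norm_sub_sq_eq_integral {F : Type*} [NormedAddCommGroup F] (f g : Lp F 2 P) :
    ‖f - g‖ ^ 2 = ∫ ω, ‖f ω - g ω‖ ^ 2 ∂P := by
  rw [Lp.norm_sq_eq_integral_norm_sq]
  exact integral_congr_ae ((Lp.coeFn_sub f g).mono fun ω h => by simp only [h, Pi.sub_apply])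

theorem Lp.norm_toLp_inner_const_le (X : Lp H 2 P) (u : H) :
    ‖((Lp.memLp X).inner_const u).toLp (fun ω => inner 𝕜 (X ω) u)‖ ≤ ‖X‖ * ‖u‖ := by
  rw [mul_comm]
  refine Lp.norm_le_mul_norm_of_ae_le_mul ?_
  filter_upwards [((Lp.memLp X).inner_const (𝕜 := 𝕜) u).coeFn_toLp] with ω h
  rw [h, mul_comm]
  exact norm_inner_le_norm _ _

variable (𝕜) in
/-- The operator `u ↦ ⟨X, u⟩` from `H` to the square-integrable scalar random variables. -/
noncomputable def innerOperator (X : Lp H 2 P) : H →L[𝕜] Lp 𝕜 2 P :=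
  LinearMap.mkContinuous
    -- Linearity forces `u` into the second slot; this is the conjugate of the coefficient `inner 𝕜
    -- u (X ω)`, with the same modulus.
    { toFun := fun u => ((Lp.memLp X).inner_const u).toLp fun ω => inner 𝕜 (X ω) u
      map_add' := fun u w => by
        rw [← MemLp.toLp_add]
        exact MemLp.toLp_congr _ _ (.of_forall fun ω => inner_add_right _ _ _)
      map_smul' := fun c u => by
        rw [RingHom.id_apply, ← MemLp.toLp_const_smul]
        exact MemLp.toLp_congr _ _ (.of_forall fun ω => inner_smul_right _ _ _) }
    ‖X‖ (Lp.norm_toLp_inner_const_le X)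

theorem coeFn_innerOperator (X : Lp H 2 P) (u : H) :
    innerOperator 𝕜 X u =ᵐ[P] fun ω => inner 𝕜 (X ω) u :=
  ((Lp.memLp X).inner_const u).coeFn_toLp

theorem norm_innerOperator_le (X : Lp H 2 P) : ‖innerOperator 𝕜 X‖ ≤ ‖X‖ :=
  LinearMap.mkContinuous_norm_le _ (norm_nonneg _) _

theorem norm_sq_innerOperator_apply (X : Lp H 2 P) (u : H) :
    ‖innerOperator 𝕜 X u‖ ^ 2 = ∫ ω, ‖inner 𝕜 u (X ω)‖ ^ 2 ∂P := by
  rw [Lp.norm_sq_eq_integral_norm_sq]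
  refine integral_congr_ae ((coeFn_innerOperator (𝕜 := 𝕜) X u).mono fun ω h => ?_)
  simp only [h, norm_inner_symm u (X ω)]

theorem integrable_norm_inner_sq (X : Lp H 2 P) (u : H) :
    Integrable (fun ω => ‖inner 𝕜 u (X ω)‖ ^ 2) P :=
  ((Lp.memLp X).const_inner (𝕜 := 𝕜) u).norm.integrable_sq

theorem innerOperator_add (X Y : Lp H 2 P) :
    innerOperator 𝕜 (X + Y) = innerOperator 𝕜 X + innerOperator 𝕜 Y := by
  ext1 u
  refine Lp.ext ?_
  filter_upwards [coeFn_innerOperator (𝕜 := 𝕜) (X + Y) u, coeFn_innerOperator (𝕜 := 𝕜) X u,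
    coeFn_innerOperator (𝕜 := 𝕜) Y u, Lp.coeFn_add X Y,
    Lp.coeFn_add (innerOperator 𝕜 X u) (innerOperator 𝕜 Y u)] with ω h₁ h₂ h₃ h₄ h₅
  rw [h₁, add_apply, h₅, h₄, Pi.add_apply, Pi.add_apply, h₂, h₃, inner_add_left]

theorem continuous_innerOperator : Continuous (innerOperator 𝕜 : Lp H 2 P → _) :=
  AddMonoidHomClass.continuous_of_bound
    (AddMonoidHom.mk' (innerOperator 𝕜 : Lp H 2 P → H →L[𝕜] Lp 𝕜 2 P) innerOperator_add) 1
    fun X => by rw [one_mul]; exact norm_innerOperator_le X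

/-- An indicator times a constant vector gives an operator of rank at most one; sums and norm limits
preserve compactness. -/
theorem isCompactOperator_innerOperator (X : Lp H 2 P) :
    IsCompactOperator (innerOperator 𝕜 X) := by
  induction X using Lp.induction (p := 2) ENNReal.ofNat_ne_top with
  | @indicatorConst c s hs hμs =>
    rw [Lp.simpleFunc.coe_indicatorConst]
    have : innerOperator 𝕜 (indicatorConstLp 2 hs hμs.ne c)
        = (ContinuousLinearMap.toSpanSingleton 𝕜 (indicatorConstLp 2 hs hμs.ne (1 : 𝕜))) ∘L
          (innerSL 𝕜 c) := by
      ext1 u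
      refine Lp.ext ?_
      filter_upwards [coeFn_innerOperator (𝕜 := 𝕜) (indicatorConstLp 2 hs hμs.ne c) u,
        indicatorConstLp_coeFn (p := 2) (hs := hs) (hμs := hμs.ne) (c := c),
        indicatorConstLp_coeFn (p := 2) (hs := hs) (hμs := hμs.ne) (c := (1 : 𝕜)),
        Lp.coeFn_smul (inner 𝕜 c u) (indicatorConstLp 2 hs hμs.ne (1 : 𝕜))] with ω h₁ h₂ h₃ h₄
      rw [h₁, h₂, comp_apply, toSpanSingleton_apply, innerSL_apply_apply, h₄, Pi.smul_apply, h₃]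
      by_cases h : ω ∈ s <;> simp [h]
    rw [this]
    exact (isCompactOperator_of_locallyCompactSpace_rng (toSpanSingleton 𝕜 _)).comp_clm _
  | add hf hg _ h₁ h₂ => rw [innerOperator_add]; exact h₁.add h₂
  | isClosed =>
    have h : IsClosed {f : H →L[𝕜] Lp 𝕜 2 P | IsCompactOperator f} :=
      isClosed_setOfPred_isCompactOperator
    exact h.preimage continuous_innerOperator

end InnerOperator

/-! ### Best low-rank approximation and distances -/

section Approximation

variable {𝕜 H S : Type*} [RCLike 𝕜] [NormedAddCommGroup H] [InnerProductSpace 𝕜 H]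
  [MeasurableSpace S] {P : Measure S}

theorem Orthonormal.integral_norm_sub_sum_inner_sq {ι : Type*} [Fintype ι] {v : ι → H}
    (hv : Orthonormal 𝕜 v) (X : Lp H 2 P) :
    ∫ ω, ‖X ω - ∑ i, inner 𝕜 (v i) (X ω) • v i‖ ^ 2 ∂P
      = ‖X‖ ^ 2 - ∑ i, ‖innerOperator 𝕜 X (v i)‖ ^ 2 := by
  simp_rw [hv.norm_sub_sum_inner_sq, norm_sq_innerOperator_apply, Lp.norm_sq_eq_integral_norm_sq]
  rw [integral_sub (Lp.memLp X).norm.integrable_sq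
    (integrable_finsetSum _ fun i _ => integrable_norm_inner_sq X (v i)),
    integral_finsetSum _ fun i _ => integrable_norm_inner_sq X (v i)]

theorem Orthonormal.exists_mem_lowRankVariables {n : ℕ} {v : Fin n → H}
    (hv : Orthonormal 𝕜 v) (X : Lp H 2 P) :
    ∃ Z ∈ lowRankVariables 𝕜 P n,
      ‖X - Z‖ ^ 2 = ‖X‖ ^ 2 - ∑ i, ‖innerOperator 𝕜 X (v i)‖ ^ 2 := by
  let L : H →L[𝕜] H := ∑ i, (innerSL 𝕜 (v i)).smulRight (v i)
  have hL (x) : L x = ∑ i, inner 𝕜 (v i) x • v i := by simp [L]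
  refine ⟨L.compLp X, ⟨Submodule.span 𝕜 (Set.range v), ?_, ?_⟩, ?_⟩
  · refine (rank_span_le _).trans ?_
    simpa using Cardinal.mk_range_le_lift (f := v)
  · filter_upwards [L.coeFn_compLp X] with ω h
    rw [h, hL]
    exact Submodule.sum_mem _ fun i _ => Submodule.smul_mem _ _ (Submodule.subset_span ⟨i, rfl⟩)
  · rw [Lp.norm_sub_sq_eq_integral, ← hv.integral_norm_sub_sum_inner_sq]
    exact integral_congr_ae ((L.coeFn_compLp X).mono fun ω h => by simp only [h, hL])

/-- The orthogonal projection onto the span of an orthonormal basis is the best approximation. -/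
theorem OrthonormalBasis.norm_sub_sum_inner_le {ι : Type*} [Fintype ι] {V : Submodule 𝕜 H}
    (b : OrthonormalBasis ι 𝕜 V) (x : H) {z : H} (hz : z ∈ V) :
    ‖x - ∑ j, inner 𝕜 (b j : H) x • (b j : H)‖ ^ 2 ≤ ‖x - z‖ ^ 2 := by
  have hb : Orthonormal 𝕜 fun j => (b j : H) := b.orthonormal.comp_linearIsometry V.subtypeₗᵢ
  have hzs : ∑ j, inner 𝕜 (b j : H) z • (b j : H) = z := by
    simpa using congrArg (Subtype.val) (b.sum_repr' ⟨z, hz⟩)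
  have h := hb.norm_sub_sum_inner_sq (x - z)
  simp only [inner_sub_right, sub_smul, Finset.sum_sub_distrib, hzs,
    sub_sub_sub_cancel_right] at h
  rw [h]
  exact sub_le_self _ (Finset.sum_nonneg fun _ _ => by positivity)

/-- Replacing `Z` by the pointwise projection of `X` onto the subspace `V` carrying `Z` only lowers
the error; Ky Fan then compares an orthonormal basis of `V` with `v`. -/
theorem norm_sq_sub_sum_le_of_mem_lowRankVariables [CompleteSpace H] {n : ℕ} {v : Fin n → H}
    {X : Lp H 2 P} (hv : IsLeadingSingularFamily (innerOperator 𝕜 X) v) {Z : Lp H 2 P}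
    (hZ : Z ∈ lowRankVariables 𝕜 P n) :
    ‖X‖ ^ 2 - ∑ i, ‖innerOperator 𝕜 X (v i)‖ ^ 2 ≤ ‖X - Z‖ ^ 2 := by
  obtain ⟨V, hV, hZV⟩ := hZ
  have : FiniteDimensional 𝕜 V :=
    Module.rank_lt_aleph0_iff.1 (hV.trans_lt (Cardinal.natCast_lt_aleph0))
  let b := stdOrthonormalBasis 𝕜 V
  have hb : Orthonormal 𝕜 fun j => (b j : H) := b.orthonormal.comp_linearIsometry V.subtypeₗᵢ
  have hcard : Fintype.card (Fin (Module.finrank 𝕜 V)) ≤ n := by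
    rw [Fintype.card_fin]
    exact Module.finrank_le_of_rank_le hV
  have h := hv.sum_norm_sq_le hb hcard
  calc ‖X‖ ^ 2 - ∑ i, ‖innerOperator 𝕜 X (v i)‖ ^ 2
      ≤ ‖X‖ ^ 2 - ∑ j, ‖innerOperator 𝕜 X (b j : H)‖ ^ 2 := by linarith
    _ = ∫ ω, ‖X ω - ∑ j, inner 𝕜 (b j : H) (X ω) • (b j : H)‖ ^ 2 ∂P :=
        (hb.integral_norm_sub_sum_inner_sq X).symm
    _ ≤ ∫ ω, ‖X ω - Z ω‖ ^ 2 ∂P := by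
        refine integral_mono_of_nonneg (.of_forall fun ω => by positivity)
          ((Lp.memLp X).sub (Lp.memLp Z)).norm.integrable_sq ?_
        exact hZV.mono fun ω hω => b.norm_sub_sum_inner_le (X ω) hω
    _ = ‖X - Z‖ ^ 2 := (Lp.norm_sub_sq_eq_integral X Z).symm

theorem IsLeadingSingularFamily.infDist_sq [CompleteSpace H] {n : ℕ} {v : Fin n → H}
    {X : Lp H 2 P} (hv : IsLeadingSingularFamily (innerOperator 𝕜 X) v) :
    Metric.infDist X (lowRankVariables 𝕜 P n) ^ 2
      = ‖X‖ ^ 2 - ∑ i, ‖innerOperator 𝕜 X (v i)‖ ^ 2 := by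
  obtain ⟨Z, hZ, hXZ⟩ := hv.orthonormal.exists_mem_lowRankVariables X
  rw [← hXZ]
  congr 1
  refine le_antisymm ((Metric.infDist_le_dist_of_mem hZ).trans_eq (dist_eq_norm _ _))
    ((Metric.le_infDist ⟨Z, hZ⟩).2 fun {Z'} hZ' => ?_)
  rw [dist_eq_norm]
  refine le_of_sq_le_sq ?_ (norm_nonneg _)
  rw [hXZ]
  exact norm_sq_sub_sum_le_of_mem_lowRankVariables hv hZ'

/-- Initial segments of a leading family are leading, so consecutive errors telescope. The right
side does not involve `v`, which gives continuity. Indices start at `0`, hence the ranks `i` and `i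
+ 1`. -/
theorem IsLeadingSingularFamily.norm_sq_eq_infDist_sq_sub [CompleteSpace H] {n : ℕ}
    {v : Fin n → H} {X : Lp H 2 P} (hv : IsLeadingSingularFamily (innerOperator 𝕜 X) v)
    (i : Fin n) :
    ‖innerOperator 𝕜 X (v i)‖ ^ 2 = Metric.infDist X (lowRankVariables 𝕜 P i) ^ 2
      - Metric.infDist X (lowRankVariables 𝕜 P (i + 1)) ^ 2 := by
  rw [(hv.comp_castLE i.is_lt).infDist_sq, (hv.comp_castLE i.is_lt.le).infDist_sq,
    Fin.sum_univ_castSucc]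
  simp only [Fin.castLE_castSucc]
  have : Fin.castLE i.is_lt (Fin.last i) = i := rfl
  rw [this]
  ring

end Approximation

/-! ### The main theorem -/

theorem theorem4p5 {𝕜 Ξ H S : Type*} [RCLike 𝕜] [MeasurableSpace Ξ]
    [NormedAddCommGroup H] [InnerProductSpace 𝕜 H] [CompleteSpace H]
    [TopologicalSpace.SeparableSpace H] [MeasurableSpace H] [BorelSpace H]
    [MeasurableSpace S] (P : Measure S) [IsProbabilityMeasure P]
    (X : Ξ → Lp H 2 P)
    (hX : @Measurable Ξ (Lp H 2 P) _ (borel (Lp H 2 P)) X)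
    (n : ℕ) (hn : 0 < n) (hdim : (n : Cardinal) ≤ Module.rank 𝕜 H) :
    ∃ v : Fin n → Ξ → H,
      (∀ i, Measurable (v i)) ∧
      (∀ ξ, Orthonormal 𝕜 (fun i => v i ξ)) ∧
      (∀ ξ, IsGLB
        ((fun Z : Lp H 2 P => ∫ ω, ‖X ξ ω - Z ω‖ ^ 2 ∂P) '' lowRankVariables 𝕜 P n)
        (∫ ω, ‖X ξ ω - ∑ i, inner 𝕜 (v i ξ) (X ξ ω) • v i ξ‖ ^ 2 ∂P)) ∧
      (∀ [TopologicalSpace Ξ],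
        (∀ ξ', Tendsto (fun ξ => ∫ ω, ‖X ξ ω - X ξ' ω‖ ^ 2 ∂P) (𝓝 ξ') (𝓝 0)) →
        ∀ i, Continuous (fun ξ => ∫ ω, ‖inner 𝕜 (v i ξ) (X ξ ω)‖ ^ 2 ∂P)) := by
  have hA (u : H) : Measurable fun ξ =>
      adjoint (innerOperator 𝕜 (X ξ)) (innerOperator 𝕜 (X ξ) u) := by
    let _ : MeasurableSpace (Lp H 2 P) := borel _
    have : BorelSpace (Lp H 2 P) := ⟨rfl⟩
    have hc : Continuous fun Y : Lp H 2 P =>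
        adjoint (innerOperator 𝕜 Y) (innerOperator 𝕜 Y u) :=
      (adjoint.continuous.comp continuous_innerOperator).clm_apply
        (continuous_innerOperator.clm_apply continuous_const)
    exact hc.measurable.comp hX
  obtain ⟨v, hvm, hv⟩ := exists_measurable_leadingSingularFamily hA
    (fun ξ => isCompactOperator_innerOperator (X ξ)) n hdim
  refine ⟨v, hvm, fun ξ => (hv ξ).orthonormal, fun ξ => IsLeast.isGLB ⟨?_, ?_⟩, ?_⟩
  · obtain ⟨Z, hZ, hXZ⟩ := (hv ξ).orthonormal.exists_mem_lowRankVariables (X ξ)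
    refine ⟨Z, hZ, ?_⟩
    rw [(hv ξ).orthonormal.integral_norm_sub_sum_inner_sq, ← hXZ, Lp.norm_sub_sq_eq_integral]
  · rintro _ ⟨Z, hZ, rfl⟩
    rw [(hv ξ).orthonormal.integral_norm_sub_sum_inner_sq]
    exact (norm_sq_sub_sum_le_of_mem_lowRankVariables (hv ξ) hZ).trans_eq
      (Lp.norm_sub_sq_eq_integral _ _)
  · intro _ hcont i
    -- The hypothesis on the topology is continuity of `X` into L², after taking square roots.
    have hXc : Continuous X := continuous_iff_continuousAt.2 fun ξ' => by
      rw [ContinuousAt, tendsto_iff_norm_sub_tendsto_zero]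
      have h := (hcont ξ').sqrt
      simp_rw [← Lp.norm_sub_sq_eq_integral, Real.sqrt_sq (norm_nonneg _), Real.sqrt_zero] at h
      exact h
    simp_rw [← norm_sq_innerOperator_apply, (hv _).norm_sq_eq_infDist_sq_sub i]
    exact (((Metric.continuous_infDist_pt _).comp hXc).pow 2).sub
      (((Metric.continuous_infDist_pt _).comp hXc).pow 2)
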